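/- For a permutation $\pi=\pi_1\cdots\pi_n\in\mathfrak S_n$ let $\mathrm{Des}(\pi)=\{i\in[n-1]:\pi_i>\pi_{i+1}\}$, $\mathrm{ides}(\pi)=|\mathrm{Des}(\pi^{-1})|$ and $\mathrm{imaj}(\pi)=\sum_{i\in\mathrm{Des}(\pi^{-1})}i$. For $m\ge 1$, $\pi$ avoids $12\cdots m$ (as a consecutive pattern) if there is no $i\in[n-m+1]$ with $\pi_i<\pi_{i+1}<\cdots<\pi_{i+m-1}$. Let $A_{12\cdots m,0}^{(\mathrm{ides},\mathrm{imaj})}(t,q)=1$ and, for $n\ge1$, $$A_{12\cdots m,n}^{(\mathrm{ides},\mathrm{imaj})}(t,q)=\sum_{\pi}t^{\mathrm{ides}(\pi)+1}q^{\mathrm{imaj}(\pi)},$$ where the sum is over all $\pi\in\mathfrak S_n$ avoiding $12\cdots m$ as a consecutive pattern. In $\mathbb Q[[t,x,q]]$ let $*$ be the Hadamard product in $t$: if $f=\sum_k f_kt^k$ and $g=\sum_k g_kt^k$ with $f_k,g_k\in\mathbb Q[[x,q]]$, then $f*g=\sum_k f_kg_kt^k$. Let $f^{*\langle n\rangle}$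 denote the $n$-fold Hadamard product of $f$ with itself, with $f^{*\langle 0\rangle}=1/(1-t)$. Let $\binom{n}{k}_q=\frac{[n]_q!}{[k]_q!\,[n-k]_q!}$ for $0\le k\le n$, where $[n]_q!=\prod_{i=1}^n(1+q+\cdots+q^{i-1})$. **Theorem.** Let $m\ge2$. In $\mathbb Q[[t,x,q]]$, all infinite sums below converge formally (each monomial has a nonzero coefficient in only finitely many terms), the series in square brackets are invertible, and (a) $$\sum_{n=0}^{\infty}\frac{A_{12\cdots m,n}^{(\mathrm{ides},\mathrm{imaj})}(t,q)}{\prod_{i=0}^{n}(1-tq^{i})}x^{n}=\sum_{n=0}^{\infty}\left(\frac{tx}{(1-t)(1-tq)}-\sum_{j=1}^{\infty}\left(\frac{tx^{jm}}{\prod_{i=0}^{jm}(1-tq^{i})}-\frac{tx^{jm+1}}{\prod_{i=0}^{jm+1}(1-tq^{i})}\right)\right)^{*\langle n\rangle};$$ (b) $$\sum_{n=0}^{\infty}\frac{A_{12\cdots m,n}^{(\mathrm{ides},\mathrm{imaj})}(t,q)}{\prod_{i=0}^{n}(1-tq^{i})}x^{n}=1+\sum_{k=1}^{\infty}\left[\sum_{j=0}^{\infty}\left(\binom{k+jm-1}{k-1}_{q}x^{jm}-\binom{k+jm}{k-1}_{q}x^{jm+1}\right)\right]^{-1}t^{k}.$$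 -/

import Mathlib

/-! ### Permutations, consecutive patterns, inverse descents

A permutation `π ∈ 𝔖ₙ` is an element of `Equiv.Perm (Fin n)`; the letter `π_i` (`1 ≤ i ≤ n`) is
the value `π ⟨i - 1, _⟩`. -/

/-- The descent set `Des(π) = {i ∈ [n-1] : π_i > π_{i+1}}`, with 1-based positions. -/
def desSet {n : ℕ} (π : Equiv.Perm (Fin n)) : Finset ℕ :=
  (Finset.Icc 1 (n - 1)).filter fun i =>
    ∃ h : i < n, π ⟨i, h⟩ < π ⟨i - 1, lt_of_le_of_lt (Nat.sub_le i 1) h⟩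

/-- The descent number. -/
def des {n : ℕ} (π : Equiv.Perm (Fin n)) : ℕ := (desSet π).card

/-- The major index, the sum of all descents. -/
def maj {n : ℕ} (π : Equiv.Perm (Fin n)) : ℕ := ∑ i ∈ desSet π, i

/-- The inverse descent number `ides(π) = des(π⁻¹)`. -/
def ides {n : ℕ} (π : Equiv.Perm (Fin n)) : ℕ := des π⁻¹

/-- The inverse major index `imaj(π) = maj(π⁻¹)`. -/
def imaj {n : ℕ} (π : Equiv.Perm (Fin n)) : ℕ := maj π⁻¹

/-- `std(π_{i+1} π_{i+2} ⋯ π_{i+m}) = σ`: the `m` consecutive letters of `π` after the first `i`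
exist and are in the same relative order as `σ`. -/
def OccursAt {m n : ℕ} (σ : Equiv.Perm (Fin m)) (π : Equiv.Perm (Fin n)) (i : ℕ) : Prop :=
  ∃ h : i + m ≤ n, ∀ a b : Fin m,
    σ a < σ b ↔ π ⟨i + a, by have := a.isLt; omega⟩ < π ⟨i + b, by have := b.isLt; omega⟩

open Classical in
/-- `occ_σ(π)`, the number of occurrences of the consecutive pattern `σ` in `π`. -/
noncomputable def occ {m n : ℕ} (σ : Equiv.Perm (Fin m)) (π : Equiv.Perm (Fin n)) : ℕ :=
  ((Finset.range (n + 1)).filter fun i => OccursAt σ π i).card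

/-- The polynomial `A_{σ,n}^{(ides,imaj)}(s,t,q) = ∑_{π ∈ 𝔖ₙ} s^{occ_σ(π)} t^{ides(π)+1} q^{imaj(π)}`
for `n ≥ 1`, and `1` for `n = 0`, evaluated at elements `s, t, q` of a commutative semiring. -/
noncomputable def idesImajPoly {R : Type*} [CommSemiring R] {m : ℕ} (σ : Equiv.Perm (Fin m))
    (n : ℕ) (s t q : R) : R :=
  if n = 0 then 1
  else ∑ π : Equiv.Perm (Fin n), s ^ occ σ π * t ^ (ides π + 1) * q ^ imaj π

/-- `A_{12⋯m,n}^{(ides,imaj)}(t,q)`: the case `s = 0` and `σ = 12⋯m`, the identity permutation. -/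
noncomputable def incPoly {R : Type*} [CommSemiring R] (m n : ℕ) (t q : R) : R :=
  idesImajPoly (1 : Equiv.Perm (Fin m)) n 0 t q

/-! ### The formal power series ring `ℚ[[t, x, q]]` -/

/-- `ℚ[[t, x, q]]`, realized as `((ℚ[[q]])[[x]])[[t]]`. -/
abbrev TXQ : Type := PowerSeries (PowerSeries (PowerSeries ℚ))

namespace TXQ

/-- The variable `t` (outermost). -/
noncomputable def t : TXQ := PowerSeries.X

/-- The variable `x` (middle). -/
noncomputable def x : TXQ := PowerSeries.C PowerSeries.X

/-- The variable `q` (innermost). -/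
noncomputable def q : TXQ := PowerSeries.C (PowerSeries.C PowerSeries.X)

/-- The coefficient of `t^a x^b q^c`. -/
noncomputable def coeff (a b c : ℕ) (f : TXQ) : ℚ :=
  PowerSeries.coeff c (PowerSeries.coeff b (PowerSeries.coeff a f))

/-- A sequence of formal power series is summable if every monomial has a nonzero coefficient in
only finitely many of its members. -/
def FormalSummable (f : ℕ → TXQ) : Prop :=
  ∀ a b c : ℕ, {n : ℕ | coeff a b c (f n) ≠ 0}.Finite

/-- The formal infinite sum `∑_{n ≥ 0} f n`, computed coefficient by coefficient (meaningful when
`FormalSummable f`). -/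
noncomputable def formalSum (f : ℕ → TXQ) : TXQ :=
  PowerSeries.mk fun a => PowerSeries.mk fun b => PowerSeries.mk fun c =>
    ∑ᶠ n : ℕ, coeff a b c (f n)

/-- The Hadamard product in `t`: coefficients of equal powers of `t` are multiplied, with ordinary
multiplication in `x` and `q`. -/
noncomputable def hadamard (f g : TXQ) : TXQ :=
  PowerSeries.mk fun k => PowerSeries.coeff k f * PowerSeries.coeff k g

/-- The identity of the Hadamard product, `∑_k t^k = 1/(1-t)`. -/
noncomputable def hadamardOne : TXQ := PowerSeries.mk fun _ => 1

theorem hadamardOne_mul_one_sub : hadamardOne * (1 - t) = 1 :=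
  PowerSeries.mk_one_mul_one_sub_eq_one _

theorem hadamardOne_hadamard (f : TXQ) : hadamard hadamardOne f = f := by
  ext1 k
  simp [hadamard, hadamardOne]

/-- The `n`-fold Hadamard product `f^{*⟨n⟩}`. -/
noncomputable def hadamardPow (f : TXQ) : ℕ → TXQ
  | 0 => hadamardOne
  | n + 1 => hadamard (hadamardPow f n) f

/-- The series `1 / ∏_{i=0}^{n} (1 - t q^i)`. -/
noncomputable def invProd (n : ℕ) : TXQ :=
  Ring.inverse (∏ i ∈ Finset.range (n + 1), (1 - t * q ^ i))

theorem prod_mul_invProd (n : ℕ) :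
    (∏ i ∈ Finset.range (n + 1), (1 - t * q ^ i)) * invProd n = 1 := by
  apply Ring.mul_inverse_cancel
  rw [PowerSeries.isUnit_iff_constantCoeff]
  simp [t]

theorem isUnit_one_sub_mul : IsUnit ((1 - t) * (1 - t * q)) := by
  rw [PowerSeries.isUnit_iff_constantCoeff]
  simp [t]

/-! ### `q`-binomial coefficients -/

/-- `[n]_q! = (1)(1+q)(1+q+q^2)⋯(1+q+⋯+q^{n-1})` in `ℚ[[q]]`. -/
noncomputable def qFactorial (n : ℕ) : PowerSeries ℚ :=
  ∏ i ∈ Finset.range n, ∑ j ∈ Finset.range (i + 1), PowerSeries.X ^ j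

theorem qFactorial_mul_inv (n : ℕ) : qFactorial n * (qFactorial n)⁻¹ = 1 := by
  apply PowerSeries.mul_inv_cancel
  simp [qFactorial, map_prod, map_sum, Finset.sum_range_succ']

/-- The `q`-binomial coefficient `[n]_q! / ([k]_q! [n-k]_q!)` for `k ≤ n`, as an element of
`ℚ[[t, x, q]]` (it is `0` for `k > n`). -/
noncomputable def qBinom (n k : ℕ) : TXQ :=
  if k ≤ n then
    PowerSeries.C (PowerSeries.C (qFactorial n * (qFactorial k)⁻¹ * (qFactorial (n - k))⁻¹))
  else 0

/-! ### The series in the theorem -/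

/-- The term `A_{12⋯m,n}^{(ides,imaj)}(t,q) / ∏_{i=0}^{n} (1 - t q^i) · x^n`. -/
noncomputable def avoidTerm (m n : ℕ) : TXQ :=
  incPoly m n t q * invProd n * x ^ n

/-- The term
`t x^{jm} / ∏_{i=0}^{jm} (1 - t q^i) - t x^{jm+1} / ∏_{i=0}^{jm+1} (1 - t q^i)`. -/
noncomputable def clusterTerm (m j : ℕ) : TXQ :=
  t * x ^ (j * m) * invProd (j * m) - t * x ^ (j * m + 1) * invProd (j * m + 1)

/-- `t x / ((1-t)(1-tq)) - ∑_{j ≥ 1} clusterTerm m j`. -/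
noncomputable def hadamardBase (m : ℕ) : TXQ :=
  t * x * Ring.inverse ((1 - t) * (1 - t * q)) - formalSum fun j => clusterTerm m (j + 1)

/-- The term `C(k+jm-1, k-1)_q x^{jm} - C(k+jm, k-1)_q x^{jm+1}` (used for `k ≥ 1`). -/
noncomputable def bracketTerm (m k j : ℕ) : TXQ :=
  qBinom (k + j * m - 1) (k - 1) * x ^ (j * m) - qBinom (k + j * m) (k - 1) * x ^ (j * m + 1)

/-- `∑_{j ≥ 0} bracketTerm m k j`. -/
noncomputable def bracket (m k : ℕ) : TXQ := formalSum fun j => bracketTerm m k j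

end TXQ

/-! Everything reduces to comparing coefficients of `t^k`, where both formulas become one identity
about words over `k` letters weighted by `q` to the sum of letters.

Group words `w` by their standardization `π`. Choosing the standardization with `π_i < π_j` iff `w_j
≤ w_i` for `i < j` turns increasing factors of `π` into weakly decreasing factors of `w`. Sorting
`w` leaves a weakly decreasing word that drops strictly at the descents of `π⁻¹`. By the generating
function of chain partitions (`decSum_generatingFunction`), the left side therefore has
`t^k`-coefficient `avoidSeries m k`, counting words without weakly decreasing factors of length `m`
(`avoidSum_eq_sum_perm`, `coeff_avoidTerm`).

This series is inverse to `signedSeries m k`, the sum of all weakly decreasing words of lengths `jm`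
with sign `+` and `jm + 1` with sign `-`. Indeed, cut a nonempty word into an avoiding prefix and a
weakly decreasing suffix; the admissible suffix lengths form an interval on which the signs sum to
zero (`sum_runSign_splittings`).

The bracket in (b) is `signedSeries m k`, because `q`-binomials count weakly decreasing words. The
base in (a) has `t^k`-coefficient `1 - signedSeries m k`, so its Hadamard powers sum to the same
inverse as a geometric series. -/

section

open Finset

/-! ### Weakly decreasing words with prescribed strict descents -/

/-- Words of length `n` over the alphabet `{0, …, k - 1}`. -/
def wordsBelow (n k : ℕ) : Finset (Fin n → ℕ) := Fintype.piFinset fun _ => range k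

theorem mem_wordsBelow {n k : ℕ} {w : Fin n → ℕ} : w ∈ wordsBelow n k ↔ ∀ i, w i < k := by
  simp [wordsBelow]

open Classical in
/-- Weakly decreasing words over `{0, …, k - 1}` with a strict decrease at every position in `D`. -/
noncomputable def decWords (n k : ℕ) (D : Finset ℕ) : Finset (Fin n → ℕ) :=
  (wordsBelow n k).filter fun v =>
    ∀ i (h : i + 1 < n), v ⟨i + 1, h⟩ + (if i + 1 ∈ D then 1 else 0) ≤ v ⟨i, by omega⟩

theorem mem_decWords {n k : ℕ} {D : Finset ℕ} {v : Fin n → ℕ} :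
    v ∈ decWords n k D ↔ (∀ i, v i < k) ∧
      ∀ i (h : i + 1 < n), v ⟨i + 1, h⟩ + (if i + 1 ∈ D then 1 else 0) ≤ v ⟨i, by omega⟩ := by
  simp [decWords, mem_wordsBelow]

theorem antitone_of_adjacent_le {n : ℕ} {v : Fin n → ℕ}
    (h : ∀ i (h : i + 1 < n), v ⟨i + 1, h⟩ ≤ v ⟨i, by omega⟩) : Antitone v := by
  have key : ∀ d i (hd : i + d < n), v ⟨i + d, hd⟩ ≤ v ⟨i, by omega⟩ := by
    intro d
    induction d with
    | zero => intro i hd; exact le_rfl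
    | succ d ih => intro i hd; exact (h (i + d) hd).trans (ih i (by omega))
  intro a b hab
  have := key (b - a) a (by have := b.isLt; have : (a : ℕ) ≤ b := hab; omega)
  have e : (a : ℕ) + (b - a) = b := by have : (a : ℕ) ≤ b := hab; omega
  simpa [e] using this

theorem antitone_of_mem_decWords {n k : ℕ} {D : Finset ℕ} {v : Fin n → ℕ}
    (hv : v ∈ decWords n k D) : Antitone v :=
  antitone_of_adjacent_le fun i h => le_trans (Nat.le_add_right _ _) ((mem_decWords.1 hv).2 i h)

variable {R : Type*} [CommRing R]

/-- The generating polynomial of `decWords n k D` by sum of letters. -/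
noncomputable def decSum (q : R) (n k : ℕ) (D : Finset ℕ) : R := ∑ v ∈ decWords n k D, q ^ ∑ i, v i

theorem decSum_zero_left (q : R) (k : ℕ) (D : Finset ℕ) : decSum q 0 k D = 1 := by
  have : decWords 0 k D = {Fin.elim0} := by
    ext v
    simp only [mem_decWords, Finset.mem_singleton]
    exact ⟨fun _ => Subsingleton.elim _ _, fun _ => ⟨fun i => i.elim0, fun i h => by omega⟩⟩
  simp [decSum, this]

theorem decSum_succ_zero (q : R) (n : ℕ) (D : Finset ℕ) : decSum q (n + 1) 0 D = 0 := by
  have : decWords (n + 1) 0 D = ∅ := by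
    ext v
    simp [mem_decWords]
  simp [decSum, this]

theorem decSum_positive_part (q : R) (n k : ℕ) (D : Finset ℕ) :
    ∑ v ∈ (decWords n (k + 1) D).filter (fun v => ∀ i, 0 < v i), q ^ ∑ i, v i =
      q ^ n * decSum q n k D := by
  rw [decSum, Finset.mul_sum]
  refine Finset.sum_bij' (fun v _ i => v i - 1) (fun v _ i => v i + 1) ?_ ?_ ?_ ?_ ?_
  · intro v hv
    obtain ⟨h1, h2⟩ := Finset.mem_filter.1 hv
    obtain ⟨h3, h4⟩ := mem_decWords.1 h1
    refine mem_decWords.2 ⟨fun i => ?_, fun i h => ?_⟩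
    · have := h2 i; have := h3 i; omega
    · have := h2 ⟨i + 1, h⟩; have := h4 i h; omega
  · intro v hv
    obtain ⟨h3, h4⟩ := mem_decWords.1 hv
    refine Finset.mem_filter.2 ⟨mem_decWords.2 ⟨fun i => ?_, fun i h => ?_⟩, fun i => ?_⟩
    · have := h3 i; omega
    · have := h4 i h; omega
    · exact Nat.succ_pos _
  · intro v hv
    obtain ⟨h1, h2⟩ := Finset.mem_filter.1 hv
    funext i
    have := h2 i
    simp only
    omega
  · intro v hv
    funext i
    simp
  · intro v hv
    obtain ⟨h1, h2⟩ := Finset.mem_filter.1 hv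
    rw [← pow_add]
    congr 1
    have : ∑ i, v i = ∑ i, (1 + (v i - 1)) :=
      Finset.sum_congr rfl fun i _ => by have := h2 i; omega
    rw [this, Finset.sum_add_distrib]
    simp

/-- Delete the final `0`. When `n ∈ D` the letter before it must be positive, and by monotonicity so
must all the others. -/
theorem decSum_last_zero_part (q : R) (n k : ℕ) (D : Finset ℕ) :
    ∑ v ∈ (decWords (n + 1) (k + 1) D).filter (fun v => v (Fin.last n) = 0), q ^ ∑ i, v i =
      ∑ v ∈ (decWords n (k + 1) D).filter (fun v => n ∈ D → ∀ i, 0 < v i), q ^ ∑ i, v i := by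
  refine Finset.sum_bij' (fun v _ => Fin.init v) (fun v _ => Fin.snoc (α := fun _ => ℕ) v 0)
    ?_ ?_ ?_ ?_ ?_
  · intro v hv
    obtain ⟨h1, h2⟩ := Finset.mem_filter.1 hv
    have hanti := antitone_of_mem_decWords h1
    obtain ⟨h3, h4⟩ := mem_decWords.1 h1
    refine Finset.mem_filter.2 ⟨mem_decWords.2 ⟨fun i => h3 _, fun i h => h4 i (by omega)⟩, ?_⟩
    intro hD i
    have hi := i.isLt
    have h5 := h4 (n - 1) (by omega)
    have h6 : n - 1 + 1 = n := by omega
    rw [if_pos (by rwa [h6])] at h5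
    have h7 : v ⟨n - 1, by omega⟩ ≤ v i.castSucc := hanti (by
      simp only [Fin.le_def, Fin.val_castSucc]; omega)
    simp only [Fin.init]
    omega
  · intro v hv
    obtain ⟨h1, h2⟩ := Finset.mem_filter.1 hv
    obtain ⟨h3, h4⟩ := mem_decWords.1 h1
    refine Finset.mem_filter.2 ⟨mem_decWords.2 ⟨fun i => ?_, fun i h => ?_⟩, by simp⟩
    · refine Fin.lastCases ?_ (fun j => ?_) i
      · simp
      · simpa using h3 j
    · by_cases hi : i + 1 < n
      · simpa [Fin.snoc, hi, show i < n by omega] using h4 i hi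
      · have e : i + 1 = n := by omega
        by_cases hD : n ∈ D
        · have := h2 hD ⟨i, by omega⟩
          simp only [Fin.snoc, e, hD]
          simpa [show i < n by omega, Nat.one_le_iff_ne_zero, Nat.pos_iff_ne_zero] using this
        · simp [Fin.snoc, e, hD]
  · intro v hv
    obtain ⟨h1, h2⟩ := Finset.mem_filter.1 hv
    rw [← h2]
    exact Fin.snoc_init_self v
  · intro v hv
    simp
  · intro v hv
    obtain ⟨h1, h2⟩ := Finset.mem_filter.1 hv
    rw [Fin.sum_univ_castSucc, h2]
    simp [Fin.init]

/-- Split by whether a zero occurs, which for a weakly decreasing word means that the last letter is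
zero. Without zeros, lower every letter by one. -/
theorem decSum_succ_succ (q : R) (n k : ℕ) (D : Finset ℕ) :
    decSum q (n + 1) (k + 1) D = q ^ (n + 1) * decSum q (n + 1) k D +
      if n ∈ D then q ^ n * decSum q n k D else decSum q n (k + 1) D := by
  have h0 : (decWords (n + 1) (k + 1) D).filter (fun v => ¬ ∀ i, 0 < v i) =
      (decWords (n + 1) (k + 1) D).filter (fun v => v (Fin.last n) = 0) := by
    refine Finset.filter_congr fun v hv => ?_
    push Not
    constructor
    · rintro ⟨i, hi⟩
      have := antitone_of_mem_decWords hv (Fin.le_last i)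
      omega
    · intro h
      exact ⟨_, h.le⟩
  rw [decSum, ← Finset.sum_filter_add_sum_filter_not _ (fun v => ∀ i, 0 < v i),
    decSum_positive_part, h0, decSum_last_zero_part]
  congr 1
  split_ifs with hD
  · simpa [hD] using decSum_positive_part q n k D
  · simp [hD, decSum]

open PowerSeries in
/-- The generating function of `(P, ω)`-partitions of a chain with strict decreases in `D`. -/
theorem decSum_generatingFunction (q : R) (D : Finset ℕ) (hD : 0 ∉ D) (n : ℕ) :
    (PowerSeries.mk fun k => decSum q n (k + 1) D) *
        ∏ i ∈ range (n + 1), (1 - (X : PowerSeries R) * C q ^ i) =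
      X ^ (D.filter (· < n)).card * C q ^ ∑ i ∈ D.filter (· < n), i := by
  induction n with
  | zero =>
    have h := PowerSeries.mk_one_mul_one_sub_eq_one R
    simpa [decSum_zero_left, Pi.one_def] using h
  | succ n ih =>
    -- This is the recursion `decSum_succ_succ` read coefficientwise. At `k = 0` with `n ∈ D` it
    -- needs `decSum q n 0 D = 0`, which fails for `n = 0`; this is where `0 ∉ D` enters.
    have step : (PowerSeries.mk fun k => decSum q (n + 1) (k + 1) D) * (1 - X * C q ^ (n + 1)) =
        (PowerSeries.mk fun k => decSum q n (k + 1) D) * (if n ∈ D then X * C q ^ n else 1) := by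
      rw [← map_pow, ← map_pow]
      ext k
      rcases k with _ | k
      · split_ifs with h
        · obtain ⟨n, rfl⟩ : ∃ n', n = n' + 1 :=
            ⟨n - 1, by rcases n with _ | n; exact absurd h hD; simp⟩
          simp [mul_sub, ← mul_assoc, decSum_succ_succ, decSum_succ_zero, h]
        · simp [mul_sub, ← mul_assoc, decSum_succ_succ, decSum_succ_zero, h]
      · rw [mul_sub, ← mul_assoc, mul_one, map_sub, coeff_mk, coeff_mul_C, coeff_succ_mul_X,
          coeff_mk, decSum_succ_succ]
        split_ifs with h
        · rw [← mul_assoc, coeff_mul_C, coeff_succ_mul_X, coeff_mk]; ring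
        · rw [mul_one, coeff_mk]; ring
    rw [Finset.prod_range_succ, mul_comm (∏ _ ∈ _, _), ← mul_assoc, step, mul_right_comm, ih]
    have hf : D.filter (· < n + 1) =
        if n ∈ D then insert n (D.filter (· < n)) else D.filter (· < n) := by
      ext a
      split_ifs with h <;> simp only [Finset.mem_filter, Finset.mem_insert] <;> constructor
      · rintro ⟨h1, h2⟩
        by_cases e : a = n
        · exact Or.inl e
        · exact Or.inr ⟨h1, by omega⟩
      · rintro (rfl | ⟨h1, h2⟩)
        · exact ⟨h, by omega⟩
        · exact ⟨h1, by omega⟩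
      · rintro ⟨h1, h2⟩
        have : a ≠ n := by rintro rfl; exact h h1
        exact ⟨h1, by omega⟩
      · rintro ⟨h1, h2⟩
        exact ⟨h1, by omega⟩
    rw [hf]
    split_ifs with h
    · rw [Finset.card_insert_of_notMem (by simp), Finset.sum_insert (by simp)]
      ring
    · rw [mul_one]

/-- The `q`-binomial theorem for weakly decreasing words, in denominator-free form. -/
theorem decSum_empty_mul_qFactorial (n k : ℕ) :
    decSum (PowerSeries.X : PowerSeries ℚ) n (k + 1) ∅ * TXQ.qFactorial n * TXQ.qFactorial k =
      TXQ.qFactorial (n + k) := by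
  have hs : ∀ n, TXQ.qFactorial (n + 1) =
      TXQ.qFactorial n * ∑ j ∈ range (n + 1), PowerSeries.X ^ j := fun n =>
    Finset.prod_range_succ _ _
  induction n generalizing k with
  | zero => simp [decSum_zero_left, TXQ.qFactorial]
  | succ n ihn =>
    have hrec : ∀ k, decSum (PowerSeries.X : PowerSeries ℚ) (n + 1) (k + 1) ∅ =
        PowerSeries.X ^ (n + 1) * decSum PowerSeries.X (n + 1) k ∅ +
          decSum PowerSeries.X n (k + 1) ∅ := by
      intro k; rw [decSum_succ_succ]; simp
    induction k with
    | zero =>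
      have := ihn 0
      rw [hrec, decSum_succ_zero]
      simp only [add_zero] at this ⊢
      rw [hs]
      linear_combination (∑ j ∈ range (n + 1), PowerSeries.X ^ j) * this
    | succ k ihk =>
      -- The splitting `[n+k+2] = [n+1] + q^(n+1) [k+1]` of the last factor matches the two terms of
      -- `hrec`.
      have e : TXQ.qFactorial (n + 1 + (k + 1)) = TXQ.qFactorial (n + 1 + k) *
          ((∑ j ∈ range (n + 1), PowerSeries.X ^ j) +
            PowerSeries.X ^ (n + 1) * ∑ j ∈ range (k + 1), PowerSeries.X ^ j) := by
        rw [show n + 1 + (k + 1) = (n + 1 + k) + 1 by ring, hs,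
          show n + 1 + k + 1 = (n + 1) + (k + 1) by ring, Finset.sum_range_add, Finset.mul_sum]
        simp only [pow_add]
      have h2 := ihn (k + 1)
      rw [show n + (k + 1) = n + 1 + k by ring] at h2
      rw [e, mul_add, hrec]
      nth_rewrite 1 [← h2]
      rw [← ihk, hs n, hs k]
      ring

theorem qBinom_eq_decSum (n k : ℕ) :
    TXQ.qBinom (k + n) k =
      PowerSeries.C (PowerSeries.C (decSum (PowerSeries.X : PowerSeries ℚ) n (k + 1) ∅)) := by
  rw [TXQ.qBinom, if_pos (Nat.le_add_right _ _), Nat.add_sub_cancel_left, add_comm k n,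
    ← decSum_empty_mul_qFactorial]
  congr 2
  have h1 := TXQ.qFactorial_mul_inv n
  have h2 := TXQ.qFactorial_mul_inv k
  linear_combination (decSum (PowerSeries.X : PowerSeries ℚ) n (k + 1) ∅) *
    (TXQ.qFactorial k * (TXQ.qFactorial k)⁻¹ * h1 + h2)

/-! ### Standardization of words -/

/-- The permutation listing the positions of `w` by decreasing letters, ties from left to right;
its inverse is the standardization of `w`. -/
def sortDesc {n : ℕ} (w : Fin n → ℕ) : Equiv.Perm (Fin n) :=
  Tuple.sort fun i => OrderDual.toDual (w i)

theorem eq_sortDesc_iff {n : ℕ} {w : Fin n → ℕ} {σ : Equiv.Perm (Fin n)} :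
    σ = sortDesc w ↔ Antitone (w ∘ σ) ∧ ∀ i j, i < j → w (σ i) = w (σ j) → σ i < σ j :=
  Tuple.eq_sort_iff

theorem symm_sortDesc_lt_iff {n : ℕ} (w : Fin n → ℕ) {i j : Fin n} (hij : i < j) :
    (sortDesc w)⁻¹ i < (sortDesc w)⁻¹ j ↔ w j ≤ w i := by
  obtain ⟨h1, h2⟩ := eq_sortDesc_iff.1 (rfl : sortDesc w = sortDesc w)
  set σ := sortDesc w
  constructor
  · intro h
    simpa using h1 h.le
  · intro h
    by_contra hn
    have hne : σ⁻¹ i ≠ σ⁻¹ j := fun e => hij.ne (σ⁻¹.injective e)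
    have hlt : σ⁻¹ j < σ⁻¹ i := lt_of_le_of_ne (not_lt.1 hn) hne.symm
    have hle : w i ≤ w j := by simpa using h1 hlt.le
    have := h2 _ _ hlt (by simpa using le_antisymm h hle)
    have hinv : ∀ x, σ (σ⁻¹ x) = x := σ.apply_symm_apply
    rw [hinv, hinv] at this
    exact absurd this (not_lt.2 hij.le)

/-- Stability of the sort means that positions increase along each block of equal letters, so a
descent of `σ` can only occur where the sorted word `v` drops. -/
theorem sortDesc_comp_inv_eq_iff {n : ℕ} (σ : Equiv.Perm (Fin n)) (v : Fin n → ℕ) :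
    sortDesc (v ∘ ⇑σ⁻¹) = σ ↔
      ∀ i (h : i + 1 < n), v ⟨i + 1, h⟩ + (if i + 1 ∈ desSet σ then 1 else 0) ≤ v ⟨i, by omega⟩ := by
  rw [eq_comm, eq_sortDesc_iff]
  have e : (v ∘ ⇑σ⁻¹) ∘ σ = v := by funext i; simp
  rw [e]
  have hinv : ∀ x, σ⁻¹ (σ x) = x := σ.symm_apply_apply
  simp only [Function.comp_apply, hinv]
  have hdes : ∀ i (h : i + 1 < n), i + 1 ∈ desSet σ ↔ σ ⟨i + 1, h⟩ < σ ⟨i, by omega⟩ := by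
    intro i h
    simp only [desSet, Finset.mem_filter, Finset.mem_Icc, Nat.add_sub_cancel]
    exact ⟨fun ⟨_, _, h⟩ => h, fun h' => ⟨by omega, h, h'⟩⟩
  constructor
  · rintro ⟨h1, h2⟩ i h
    have hlt : (⟨i, by omega⟩ : Fin n) < ⟨i + 1, h⟩ := by simp
    have h3 := h1 hlt.le
    split_ifs with hd
    · rw [hdes i h] at hd
      by_contra hc
      exact absurd (h2 _ _ hlt (by omega)) (not_lt.2 hd.le)
    · simpa using h3
  · intro H
    have hanti : Antitone v :=
      antitone_of_adjacent_le fun i h => le_trans (Nat.le_add_right _ _) (H i h)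
    refine ⟨hanti, ?_⟩
    -- Equal letters at the ends force equality throughout the stretch between them, hence no
    -- descent of `σ` there.
    have key : ∀ d i (hd : i + (d + 1) < n), v ⟨i, by omega⟩ = v ⟨i + (d + 1), hd⟩ →
        σ ⟨i, by omega⟩ < σ ⟨i + (d + 1), hd⟩ := by
      intro d
      induction d with
      | zero =>
        intro i hd hv
        have h1 := H i hd
        have h2 : i + 1 ∉ desSet σ := by
          intro h
          rw [if_pos h] at h1
          simp only [zero_add] at hv
          omega
        rw [hdes i hd] at h2
        refine lt_of_le_of_ne (not_lt.1 h2) fun e => ?_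
        have := congrArg Fin.val (σ.injective e)
        simp at this
      | succ d ih =>
        intro i hd hv
        have a1 : v ⟨i + (d + 1), by omega⟩ ≤ v ⟨i, by omega⟩ := hanti (by simp [Fin.le_def])
        have a2 : v ⟨i + (d + 1 + 1), hd⟩ ≤ v ⟨i + (d + 1), by omega⟩ :=
          hanti (by simp only [Fin.le_def]; omega)
        have b1 := ih i (by omega) (by omega)
        refine b1.trans ?_
        have h1 := H (i + (d + 1)) hd
        have h2 : i + (d + 1) + 1 ∉ desSet σ := by
          intro h
          rw [if_pos h] at h1
          have e : v ⟨i + (d + 1) + 1, hd⟩ = v ⟨i + (d + 1 + 1), hd⟩ := rfl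
          omega
        rw [hdes (i + (d + 1)) hd] at h2
        refine lt_of_le_of_ne (not_lt.1 h2) fun e => ?_
        have := congrArg Fin.val (σ.injective e)
        simp at this
    rintro ⟨i, hi⟩ ⟨j, hj⟩ hij hv
    obtain ⟨d, rfl⟩ : ∃ d, j = i + (d + 1) :=
      ⟨j - i - 1, by have : i < j := hij; omega⟩
    exact key d i hj hv

/-- Words with a given standardization correspond to weakly decreasing words that decrease strictly
at the inverse descents. -/
theorem sum_sortDesc_fiber (q : R) (n k : ℕ) (σ : Equiv.Perm (Fin n)) :
    ∑ w ∈ (wordsBelow n k).filter (fun w => sortDesc w = σ), q ^ ∑ i, w i =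
      decSum q n k (desSet σ) := by
  refine Finset.sum_bij' (fun w _ => w ∘ σ) (fun v _ => v ∘ ⇑σ⁻¹) ?_ ?_ ?_ ?_ ?_
  · intro w hw
    obtain ⟨h1, h2⟩ := Finset.mem_filter.1 hw
    refine mem_decWords.2 ⟨fun i => mem_wordsBelow.1 h1 _, ?_⟩
    refine (sortDesc_comp_inv_eq_iff σ (w ∘ σ)).1 ?_
    have e : (w ∘ σ) ∘ ⇑σ⁻¹ = w := by funext i; simp
    rwa [e]
  · intro v hv
    obtain ⟨h1, h2⟩ := mem_decWords.1 hv
    exact Finset.mem_filter.2 ⟨mem_wordsBelow.2 fun i => h1 _,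
      (sortDesc_comp_inv_eq_iff σ v).2 h2⟩
  · intro w _; funext i; simp
  · intro w _; funext i; simp
  · intro w _
    congr 1
    exact (Equiv.sum_comp σ w).symm

/-! ### Words avoiding weakly decreasing factors -/

/-- The word `w`, continued by zeros. -/
def extendZero {n : ℕ} (w : Fin n → ℕ) (i : ℕ) : ℕ := if h : i < n then w ⟨i, h⟩ else 0

/-- The first `a` letters of `f` contain no weakly decreasing factor of length `m`. -/
def AvoidsDec (m a : ℕ) (f : ℕ → ℕ) : Prop :=
  ∀ i, i + m ≤ a → ¬ AntitoneOn f (Set.Ico i (i + m))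

open Classical in
/-- The words over `{0, …, k - 1}` without weakly decreasing factors of length `m`, by sum. -/
noncomputable def avoidSum (q : R) (m n k : ℕ) : R :=
  ∑ w ∈ (wordsBelow n k).filter (fun w => AvoidsDec m n (extendZero w)), q ^ ∑ i, w i

theorem occursAt_one_inv_sortDesc_iff {m n : ℕ} (w : Fin n → ℕ) (i : ℕ) :
    OccursAt (1 : Equiv.Perm (Fin m)) (sortDesc w)⁻¹ i ↔
      i + m ≤ n ∧ AntitoneOn (extendZero w) (Set.Ico i (i + m)) := by
  constructor
  · rintro ⟨h, H⟩
    refine ⟨h, ?_⟩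
    intro a ha b hb hab
    rw [Set.mem_Ico] at ha hb
    rcases hab.eq_or_lt with rfl | hlt
    · exact le_rfl
    · have h1 := (H ⟨a - i, by omega⟩ ⟨b - i, by omega⟩).1 (by
        simp only [Equiv.Perm.coe_one, id, Fin.mk_lt_mk]; omega)
      have ea : i + (a - i) = a := by omega
      have eb : i + (b - i) = b := by omega
      simp only [ea, eb] at h1
      rw [symm_sortDesc_lt_iff w (by simpa using hlt)] at h1
      simpa [extendZero, show a < n by omega, show b < n by omega] using h1
  · rintro ⟨h, H⟩
    have key : ∀ a b : Fin m, a < b → (sortDesc w)⁻¹ ⟨i + a, by have := a.isLt; omega⟩ <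
        (sortDesc w)⁻¹ ⟨i + b, by have := b.isLt; omega⟩ := by
      intro a b hab
      have ha := a.isLt
      have hb := b.isLt
      have hab' : (a : ℕ) < b := hab
      rw [symm_sortDesc_lt_iff w (by simpa using hab)]
      have := H (a := i + a) (by simp) (b := i + b) (by simp) (by omega)
      simpa [extendZero, show i + (a : ℕ) < n by omega, show i + (b : ℕ) < n by omega] using this
    refine ⟨h, fun a b => ⟨fun hab => key a b hab, fun hlt => ?_⟩⟩
    simp only [Equiv.Perm.coe_one, id]
    rcases lt_trichotomy a b with hab | rfl | hab
    · exact hab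
    · exact absurd hlt (lt_irrefl _)
    · exact absurd hlt (not_lt.2 (key b a hab).le)

theorem occ_one_inv_sortDesc_eq_zero_iff {m n : ℕ} (w : Fin n → ℕ) :
    occ (1 : Equiv.Perm (Fin m)) (sortDesc w)⁻¹ = 0 ↔ AvoidsDec m n (extendZero w) := by
  simp only [occ, Finset.card_eq_zero, Finset.filter_eq_empty_iff, Finset.mem_range,
    occursAt_one_inv_sortDesc_iff, AvoidsDec]
  constructor
  · intro h i hi ha
    exact h (by omega) ⟨hi, ha⟩
  · rintro h i _ ⟨hi, ha⟩
    exact h i hi ha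

/-- Avoidance depends only on the standardization of a word, so the sum can be taken fibre by fibre.
-/
theorem avoidSum_eq_sum_perm (q : R) (m n k : ℕ) :
    avoidSum q m n k =
      ∑ π : Equiv.Perm (Fin n), 0 ^ occ (1 : Equiv.Perm (Fin m)) π * decSum q n k (desSet π⁻¹) := by
  classical
  rw [avoidSum, Finset.sum_filter,
    ← Finset.sum_fiberwise (wordsBelow n k) (fun w => (sortDesc w)⁻¹)]
  refine Finset.sum_congr rfl fun π _ => ?_
  rw [← sum_sortDesc_fiber, Finset.mul_sum]
  have hset : (wordsBelow n k).filter (fun w => (sortDesc w)⁻¹ = π) =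
      (wordsBelow n k).filter (fun w => sortDesc w = π⁻¹) :=
    Finset.filter_congr fun w _ => inv_eq_iff_eq_inv
  rw [hset]
  refine Finset.sum_congr rfl fun w hw => ?_
  have hw2 : (sortDesc w)⁻¹ = π := by rw [(Finset.mem_filter.1 hw).2, inv_inv]
  rw [← hw2, zero_pow_eq, ite_mul, one_mul, zero_mul]
  exact if_congr (occ_one_inv_sortDesc_eq_zero_iff w).symm rfl rfl

/-! ### Sign cancellation and the inversion formula -/

/-- `1` if `r ≡ 0`, `-1` if `r ≡ 1` modulo `m`, and `0` otherwise. -/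
def runSign (R : Type*) [CommRing R] (m r : ℕ) : R :=
  (if r % m = 0 then 1 else 0) - (if r % m = 1 then 1 else 0)

theorem sum_range_runSign {m l : ℕ} (hl : 2 ≤ l) (hlm : l ≤ m) :
    ∑ i ∈ range l, runSign R m i = 0 := by
  obtain ⟨l, rfl⟩ : ∃ l', l = l' + 2 := ⟨l - 2, by omega⟩
  rw [add_comm l 2, Finset.sum_range_add]
  have h : ∀ i ∈ range l, runSign R m (2 + i) = 0 := by
    intro i hi
    rw [Finset.mem_range] at hi
    rw [runSign, Nat.mod_eq_of_lt (by omega), if_neg (by omega), if_neg (by omega), sub_zero]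
  rw [Finset.sum_eq_zero h]
  rw [Finset.sum_range_succ, Finset.sum_range_one]
  simp [runSign, Nat.mod_eq_of_lt (show 1 < m by omega)]

theorem sum_period_runSign {m : ℕ} (hm : 2 ≤ m) (s : ℕ) :
    ∑ i ∈ range m, runSign R m (s + i) = 0 := by
  induction s with
  | zero => simpa using sum_range_runSign (R := R) hm le_rfl
  | succ s ih =>
    have h1 := Finset.sum_range_succ (fun i => runSign R m (s + i)) m
    have h2 := Finset.sum_range_succ' (fun i => runSign R m (s + i)) m
    have e : runSign R m (s + m) = runSign R m s := by simp [runSign]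
    simp only [e, add_zero] at h1 h2
    rw [h1, ih] at h2
    have h3 : ∀ i, s + 1 + i = s + (i + 1) := fun i => by ring
    simp only [h3]
    linear_combination -h2

open Classical in
/-- Splitting a nonempty sequence as a prefix without long weakly decreasing factors followed by a
weakly decreasing suffix, in all ways: the signs cancel. -/
theorem sum_runSign_splittings {m : ℕ} (hm : 2 ≤ m) (f : ℕ → ℕ) {n : ℕ} (hn : 0 < n) :
    ∑ r ∈ (range (n + 1)).filter
      (fun r => AvoidsDec m (n - r) f ∧ AntitoneOn f (Set.Ico (n - r) n)), runSign R m r = 0 := by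
  set S := (range (n + 1)).filter
    (fun r => AvoidsDec m (n - r) f ∧ AntitoneOn f (Set.Ico (n - r) n)) with hS
  have hmem : ∀ r, r ∈ S ↔ r ≤ n ∧ AvoidsDec m (n - r) f ∧ AntitoneOn f (Set.Ico (n - r) n) := by
    intro r
    simp [hS]
  have avoid_mono : ∀ a b, a ≤ b → AvoidsDec m b f → AvoidsDec m a f :=
    fun a b hab h i hi => h i (hi.trans hab)
  have anti_mono : ∀ a b, a ≤ b → AntitoneOn f (Set.Ico a n) → AntitoneOn f (Set.Ico b n) :=
    fun a b hab h => h.mono (Set.Ico_subset_Ico_left hab)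
  rcases S.eq_empty_or_nonempty with he | hne
  · rw [he, Finset.sum_empty]
  · set A := S.min' hne with hA
    set B := S.max' hne with hB
    obtain ⟨hA1, hA2, hA3⟩ := (hmem A).1 (S.min'_mem hne)
    obtain ⟨hB1, hB2, hB3⟩ := (hmem B).1 (S.max'_mem hne)
    have hAB : A ≤ B := S.min'_le _ (S.max'_mem hne)
    have hmaxB : ∀ r, r ≤ n → A ≤ r → AntitoneOn f (Set.Ico (n - r) n) → r ≤ B := fun r h1 h2 h3 =>
      S.le_max' _ ((hmem r).2 ⟨h1, avoid_mono _ _ (by omega) hA2, h3⟩)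
    -- Shortening the prefix preserves avoidance and shortening the suffix preserves monotonicity,
    -- so nothing between the extreme suffix lengths is missing.
    have hSI : S = Finset.Icc A B := by
      ext r
      rw [Finset.mem_Icc]
      constructor
      · exact fun h => ⟨S.min'_le _ h, S.le_max' _ h⟩
      · rintro ⟨h1, h2⟩
        exact (hmem r).2 ⟨by omega, avoid_mono _ _ (by omega) hA2, anti_mono _ _ (by omega) hB3⟩
    have hsum : ∑ r ∈ S, runSign R m r = ∑ i ∈ range (B + 1 - A), runSign R m (A + i) := by
      rw [hSI, ← Finset.sum_Ico_eq_sum_range]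
      rfl
    rw [hsum]
    -- If `A = 0` the whole word avoids, so `1 ≤ B < m` and the range contains exactly one `+1` and
    -- one `-1`. Otherwise `B = A + m - 1` and the range is a full period.
    rcases Nat.eq_zero_or_pos A with h0 | hpos
    · rw [h0] at hA2 hmaxB ⊢
      have h1 : 1 ≤ B := hmaxB 1 (by omega) (by omega) (by
        intro a ha b hb _
        rw [Set.mem_Ico] at ha hb
        rw [show a = b by omega])
      have h2 : B < m := by
        by_contra hc
        refine hA2 (n - m) (by omega) ?_
        exact (anti_mono (n - B) (n - m) (by omega) hB3).mono
          (Set.Ico_subset_Ico_right (by omega))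
      simpa using sum_range_runSign (R := R) (m := m) (l := B + 1) (by omega) (by omega)
    · -- the prefix of length `n - A + 1` ends with a weakly decreasing factor of length `m`
      have hbad : ∃ i, i + m = n - A + 1 ∧ AntitoneOn f (Set.Ico i (i + m)) := by
        have hnot : ¬ AvoidsDec m (n - (A - 1)) f := by
          intro h
          have := S.min'_le _ ((hmem (A - 1)).2 ⟨by omega, h, anti_mono _ _ (by omega) hA3⟩)
          omega
        simp only [AvoidsDec] at hnot
        push Not at hnot
        obtain ⟨i, hi1, hi2⟩ := hnot
        refine ⟨i, ?_, hi2⟩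
        by_contra hc
        exact hA2 i (by omega) hi2
      obtain ⟨i, hi1, hi2⟩ := hbad
      -- The bad factor and the suffix of length `A` share position `n - A`, so monotonicity passes
      -- across it.
      have hglue : AntitoneOn f (Set.Ico i n) := by
        intro a ha b hb hab
        rw [Set.mem_Ico] at ha hb
        by_cases hb' : b < n - A + 1
        · exact hi2 (Set.mem_Ico.2 ⟨ha.1, by omega⟩) (Set.mem_Ico.2 ⟨hb.1, by omega⟩) hab
        · by_cases ha' : n - A ≤ a
          · exact hA3 (Set.mem_Ico.2 ⟨by omega, by omega⟩) (Set.mem_Ico.2 ⟨by omega, by omega⟩) hab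
          · exact (hA3 (a := n - A) (Set.mem_Ico.2 ⟨by omega, by omega⟩)
              (Set.mem_Ico.2 ⟨by omega, by omega⟩) (by omega)).trans
              (hi2 (Set.mem_Ico.2 ⟨by omega, by omega⟩) (Set.mem_Ico.2 ⟨by omega, by omega⟩)
                (by omega))
      have hge : A + m - 1 ≤ B := by
        refine hmaxB _ (by omega) (by omega) ?_
        rwa [show n - (A + m - 1) = i by omega]
      -- A longer suffix would put `m` weakly decreasing letters at the end of the avoiding prefix
      -- of length `n - A`.
      have hle : B ≤ A + m - 1 := by
        by_contra hc
        refine hA2 (n - A - m) (by omega) ?_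
        exact (anti_mono (n - B) (n - A - m) (by omega) hB3).mono
          (Set.Ico_subset_Ico_right (by omega))
      rw [show B + 1 - A = m by omega]
      exact sum_period_runSign hm A

theorem extendZero_append_left {a r : ℕ} (u : Fin a → ℕ) (v : Fin r → ℕ) {i : ℕ} (h : i < a) :
    extendZero (Fin.append u v) i = extendZero u i := by
  have := Fin.append_left u v ⟨i, h⟩
  simpa [extendZero, h, show i < a + r by omega] using this

theorem extendZero_append_right {a r : ℕ} (u : Fin a → ℕ) (v : Fin r → ℕ) {i : ℕ} (h : i < r) :
    extendZero (Fin.append u v) (a + i) = extendZero v i := by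
  have := Fin.append_right u v ⟨i, h⟩
  simpa [extendZero, h] using this

theorem mem_decWords_empty_iff {r k : ℕ} {v : Fin r → ℕ} :
    v ∈ decWords r k ∅ ↔ v ∈ wordsBelow r k ∧ AntitoneOn (extendZero v) (Set.Ico 0 r) := by
  rw [mem_decWords, mem_wordsBelow]
  refine and_congr_right fun _ => ⟨fun h => ?_, fun h i hi => ?_⟩
  · have hanti : Antitone v := antitone_of_adjacent_le fun i hi => by simpa using h i hi
    intro a ha b hb hab
    rw [Set.mem_Ico] at ha hb
    simpa [extendZero, ha.2, hb.2] using
      hanti (show (⟨a, ha.2⟩ : Fin r) ≤ ⟨b, hb.2⟩ from hab)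
  · have := h (a := i) (Set.mem_Ico.2 ⟨by omega, by omega⟩) (b := i + 1)
      (Set.mem_Ico.2 ⟨by omega, by omega⟩) (by omega)
    simpa [extendZero, hi, show i < r by omega] using this

-- Concatenation of words: avoidance constrains only the first `a` letters, monotonicity only the
-- last `r`.
open Classical in
theorem avoidSum_mul_decSum (q : R) (m a r k : ℕ) :
    avoidSum q m a k * decSum q r k ∅ =
      ∑ w ∈ (wordsBelow (a + r) k).filter (fun w => AvoidsDec m a (extendZero w) ∧
        AntitoneOn (extendZero w) (Set.Ico a (a + r))), q ^ ∑ i, w i := by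
  rw [avoidSum, decSum, Finset.sum_mul_sum, ← Finset.sum_product']
  refine Finset.sum_equiv (Fin.appendEquiv a r) ?_ ?_
  · rintro ⟨u, v⟩
    simp only [Finset.mem_product, Finset.mem_filter, mem_decWords_empty_iff, mem_wordsBelow,
      show Fin.appendEquiv a r (u, v) = Fin.append u v from rfl]
    have hw : (∀ i, Fin.append u v i < k) ↔ (∀ i, u i < k) ∧ ∀ i, v i < k := by
      constructor
      · intro h
        exact ⟨fun i => by simpa using h (Fin.castAdd r i), fun i => by simpa using h (Fin.natAdd a i)⟩
      · rintro ⟨h1, h2⟩ i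
        refine Fin.addCases (fun j => ?_) (fun j => ?_) i
        · simpa using h1 j
        · simpa using h2 j
    have h1 : AvoidsDec m a (extendZero (Fin.append u v)) ↔ AvoidsDec m a (extendZero u) := by
      refine forall_congr' fun i => forall_congr' fun hi => not_congr ?_
      have : Set.EqOn (extendZero (Fin.append u v)) (extendZero u) (Set.Ico i (i + m)) :=
        fun j hj => extendZero_append_left u v (hj.2.trans_le hi)
      exact this.congr_antitoneOn
    have h2 : AntitoneOn (extendZero (Fin.append u v)) (Set.Ico a (a + r)) ↔
        AntitoneOn (extendZero v) (Set.Ico 0 r) := by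
      constructor
      · intro h x hx y hy hxy
        rw [Set.mem_Ico] at hx hy
        have := h (a := a + x) (Set.mem_Ico.2 ⟨by omega, by omega⟩) (b := a + y)
          (Set.mem_Ico.2 ⟨by omega, by omega⟩) (by omega)
        rwa [extendZero_append_right u v hx.2, extendZero_append_right u v hy.2] at this
      · intro h x hx y hy hxy
        rw [Set.mem_Ico] at hx hy
        obtain ⟨x, rfl⟩ := Nat.exists_eq_add_of_le hx.1
        obtain ⟨y, rfl⟩ := Nat.exists_eq_add_of_le hy.1
        rw [extendZero_append_right u v (by omega), extendZero_append_right u v (by omega)]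
        exact h (Set.mem_Ico.2 ⟨by omega, by omega⟩) (Set.mem_Ico.2 ⟨by omega, by omega⟩) (by omega)
    rw [hw, h1, h2]
    tauto
  · rintro ⟨u, v⟩ _
    simp [Fin.sum_univ_add, pow_add]

theorem avoidSum_zero (q : R) {m : ℕ} (hm : 0 < m) (k : ℕ) : avoidSum q m 0 k = 1 := by
  classical
  have : (wordsBelow 0 k).filter (fun w => AvoidsDec m 0 (extendZero w)) = {Fin.elim0} := by
    ext v
    simp only [Finset.mem_filter, mem_wordsBelow, Finset.mem_singleton]
    exact ⟨fun _ => Subsingleton.elim _ _,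
      fun _ => ⟨fun i => i.elim0, fun i hi => by omega⟩⟩
  simp [avoidSum, this]

/-- The inversion formula for words avoiding weakly decreasing factors of length `m`. -/
theorem sum_antidiagonal_avoidSum_mul_decSum (q : R) {m : ℕ} (hm : 2 ≤ m) (n k : ℕ) :
    ∑ p ∈ antidiagonal n, avoidSum q m p.1 k * (runSign R m p.2 * decSum q p.2 k ∅) =
      if n = 0 then 1 else 0 := by
  classical
  rcases Nat.eq_zero_or_pos n with rfl | hn
  · simp [avoidSum_zero q (show 0 < m by omega), decSum_zero_left, runSign]
  -- Reindex by the suffix length `r`, so that for each fixed word the sum over `r` is the one in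
  -- `sum_runSign_splittings`.
  rw [if_neg hn.ne', Finset.Nat.sum_antidiagonal_eq_sum_range_succ_mk, ← Finset.sum_range_reflect]
  have h : ∀ r ∈ range (n + 1), avoidSum q m (n + 1 - 1 - r) k *
        (runSign R m (n - (n + 1 - 1 - r)) * decSum q (n - (n + 1 - 1 - r)) k ∅) =
      ∑ w ∈ wordsBelow n k, (if AvoidsDec m (n - r) (extendZero w) ∧
        AntitoneOn (extendZero w) (Set.Ico (n - r) n) then runSign R m r else 0) *
          q ^ ∑ i, w i := by
    intro r hr
    rw [Finset.mem_range] at hr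
    obtain ⟨a, rfl⟩ : ∃ a, n = a + r := ⟨n - r, by omega⟩
    have e1 : a + r + 1 - 1 - r = a := by omega
    have e2 : a + r - a = r := by omega
    have e3 : a + r - r = a := by omega
    rw [e1, e2, e3, mul_left_comm, avoidSum_mul_decSum, Finset.sum_filter, Finset.mul_sum]
    refine Finset.sum_congr rfl fun w _ => ?_
    split_ifs <;> simp
  rw [Finset.sum_congr rfl h, Finset.sum_comm]
  refine Finset.sum_eq_zero fun w _ => ?_
  rw [← Finset.sum_mul, ← Finset.sum_filter, sum_runSign_splittings hm _ hn, zero_mul]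

/-! ### Coefficients of `t^k` in the left-hand side -/

theorem zero_notMem_desSet {n : ℕ} (σ : Equiv.Perm (Fin n)) : 0 ∉ desSet σ := by
  simp [desSet]

theorem desSet_filter_lt {n : ℕ} (hn : 0 < n) (σ : Equiv.Perm (Fin n)) :
    (desSet σ).filter (· < n) = desSet σ := by
  refine Finset.filter_true_of_mem fun i hi => ?_
  have := (Finset.mem_Icc.1 (Finset.mem_filter.1 hi).1).2
  omega

namespace TXQ

theorem formalSummable_of_X_pow_dvd {f : ℕ → TXQ}
    (h : ∀ a n, PowerSeries.X ^ n ∣ PowerSeries.coeff a (f n)) : FormalSummable f := by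
  intro a b c
  refine (Set.finite_Iic b).subset fun n hn => ?_
  by_contra hc
  rw [Set.mem_Iic, not_le] at hc
  refine hn ?_
  rw [coeff, PowerSeries.X_pow_dvd_iff.1 (h a n) b hc, map_zero]

/-- Divisibility by `x^n`, uniform in the power of `t`, lets only terms with `n ≤ b` reach `x^b`;
the cutoff `N` stays free for later reindexing. -/
theorem coeff_formalSum_of_X_pow_dvd {f : ℕ → TXQ}
    (h : ∀ a n, PowerSeries.X ^ n ∣ PowerSeries.coeff a (f n)) (a b : ℕ) {N : ℕ} (hN : b < N) :
    PowerSeries.coeff b (PowerSeries.coeff a (formalSum f)) =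
      ∑ n ∈ range N, PowerSeries.coeff b (PowerSeries.coeff a (f n)) := by
  ext c
  rw [formalSum, PowerSeries.coeff_mk, PowerSeries.coeff_mk, PowerSeries.coeff_mk, map_sum]
  refine finsum_eq_sum_of_support_subset _ fun n hn => ?_
  by_contra hc
  rw [Finset.coe_range, Set.mem_Iio, not_lt] at hc
  refine hn ?_
  change PowerSeries.coeff c (PowerSeries.coeff b (PowerSeries.coeff a (f n))) = 0
  rw [PowerSeries.X_pow_dvd_iff.1 (h a n) b (by omega), map_zero]

theorem decSum_C_X (n k : ℕ) (D : Finset ℕ) :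
    decSum (PowerSeries.C (PowerSeries.X : PowerSeries ℚ)) n k D =
      PowerSeries.C (decSum PowerSeries.X n k D) := by
  simp [decSum]

theorem avoidSum_C_X (m n k : ℕ) :
    avoidSum (PowerSeries.C (PowerSeries.X : PowerSeries ℚ)) m n k =
      PowerSeries.C (avoidSum PowerSeries.X m n k) := by
  simp [avoidSum]

theorem pow_mul_invProd (D : Finset ℕ) (hD : 0 ∉ D) (n : ℕ) :
    t ^ (D.filter (· < n)).card * q ^ (∑ i ∈ D.filter (· < n), i) * invProd n =
      PowerSeries.mk fun k => decSum (PowerSeries.C (PowerSeries.X : PowerSeries ℚ)) n (k + 1) D := by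
  have h := decSum_generatingFunction (PowerSeries.C (PowerSeries.X : PowerSeries ℚ)) D hD n
  have h2 : t ^ (D.filter (· < n)).card * q ^ (∑ i ∈ D.filter (· < n), i) =
      (PowerSeries.mk fun k =>
        decSum (PowerSeries.C (PowerSeries.X : PowerSeries ℚ)) n (k + 1) D) *
        ∏ i ∈ range (n + 1), (1 - t * q ^ i) := h.symm
  rw [h2, mul_assoc, prod_mul_invProd, mul_one]

theorem invProd_eq_mk (n : ℕ) :
    invProd n = PowerSeries.mk fun k => PowerSeries.C (decSum PowerSeries.X n (k + 1) ∅) := by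
  simpa [decSum_C_X] using pow_mul_invProd ∅ (by simp) n

/-- The extra factor `t` shifts the index, so that `t^k` corresponds to exactly `k` letters; at `k =
0` both sides vanish because `n > 0`. -/
theorem coeff_t_pow_mul_invProd {n : ℕ} (hn : 0 < n) (σ : Equiv.Perm (Fin n)) (k : ℕ) :
    PowerSeries.coeff k (t ^ (des σ + 1) * q ^ maj σ * invProd n) =
      decSum (PowerSeries.C (PowerSeries.X : PowerSeries ℚ)) n k (desSet σ) := by
  have h := pow_mul_invProd (desSet σ) (zero_notMem_desSet σ) n
  rw [desSet_filter_lt hn] at h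
  have e : t ^ (des σ + 1) * q ^ maj σ * invProd n = (PowerSeries.mk fun k =>
      decSum (PowerSeries.C (PowerSeries.X : PowerSeries ℚ)) n (k + 1) (desSet σ)) *
        PowerSeries.X := by
    rw [← h, des, maj, pow_succ, t]
    ring
  rw [e]
  rcases k with _ | k
  · obtain ⟨n, rfl⟩ : ∃ n', n = n' + 1 := ⟨n - 1, by omega⟩
    simp [decSum_succ_zero]
  · rw [PowerSeries.coeff_succ_mul_X, PowerSeries.coeff_mk]

theorem x_pow (n : ℕ) : x ^ n = PowerSeries.C (PowerSeries.X ^ n) := by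
  rw [x, map_pow]

theorem coeff_avoidTerm {m : ℕ} (hm : 0 < m) (n k : ℕ) :
    PowerSeries.coeff k (avoidTerm m n) =
      PowerSeries.C (avoidSum PowerSeries.X m n k) * PowerSeries.X ^ n := by
  rw [avoidTerm, x_pow, PowerSeries.coeff_mul_C]
  congr 1
  rcases Nat.eq_zero_or_pos n with rfl | hn
  · rw [avoidSum_zero _ hm, incPoly, idesImajPoly, if_pos rfl, one_mul, invProd_eq_mk]
    simp [decSum_zero_left]
  · rw [incPoly, idesImajPoly, if_neg hn.ne', ← avoidSum_C_X, avoidSum_eq_sum_perm,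
      Finset.sum_mul, map_sum]
    refine Finset.sum_congr rfl fun π _ => ?_
    rw [mul_assoc (0 ^ _), mul_assoc (0 ^ _), ides, imaj, ← coeff_t_pow_mul_invProd hn]
    -- The powers of `0` on the two sides live in different rings, hence the case split.
    rcases Nat.eq_zero_or_pos (occ (1 : Equiv.Perm (Fin m)) π) with h | h
    · rw [h, pow_zero, pow_zero, one_mul, one_mul]
    · rw [zero_pow h.ne', zero_pow h.ne', zero_mul, zero_mul, map_zero]

/-! ### Inverse series for a fixed alphabet and the brackets of (b) -/

/-- The series `∑ₙ Wₙ xⁿ` for words over `k` letters avoiding weakly decreasing factors of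
length `m`. -/
noncomputable def avoidSeries (m k : ℕ) : PowerSeries (PowerSeries ℚ) :=
  PowerSeries.mk fun n => avoidSum PowerSeries.X m n k

/-- The series `∑ⱼ (h_{jm} x^{jm} - h_{jm+1} x^{jm+1})` of weakly decreasing words over `k`
letters. -/
noncomputable def signedSeries (m k : ℕ) : PowerSeries (PowerSeries ℚ) :=
  PowerSeries.mk fun r => runSign _ m r * decSum PowerSeries.X r k ∅

/-- The `j`-th summand of `signedSeries`. -/
noncomputable def signedTerm (m k j : ℕ) : PowerSeries (PowerSeries ℚ) :=
  PowerSeries.C (decSum PowerSeries.X (j * m) k ∅) * PowerSeries.X ^ (j * m) -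
    PowerSeries.C (decSum PowerSeries.X (j * m + 1) k ∅) * PowerSeries.X ^ (j * m + 1)

theorem avoidSeries_mul_signedSeries {m : ℕ} (hm : 2 ≤ m) (k : ℕ) :
    avoidSeries m k * signedSeries m k = 1 := by
  ext1 n
  rw [PowerSeries.coeff_mul, PowerSeries.coeff_one,
    ← sum_antidiagonal_avoidSum_mul_decSum PowerSeries.X hm n k]
  simp [avoidSeries, signedSeries]

theorem X_pow_dvd_coeff_avoidTerm {m : ℕ} (hm : 0 < m) (a n : ℕ) :
    PowerSeries.X ^ n ∣ PowerSeries.coeff a (avoidTerm m n) := by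
  rw [coeff_avoidTerm hm]
  exact dvd_mul_left _ _

theorem coeff_formalSum_avoidTerm {m : ℕ} (hm : 0 < m) (k : ℕ) :
    PowerSeries.coeff k (formalSum fun n => avoidTerm m n) = avoidSeries m k := by
  ext1 b
  rw [coeff_formalSum_of_X_pow_dvd (X_pow_dvd_coeff_avoidTerm hm) k b (Nat.lt_succ_self b)]
  simp only [coeff_avoidTerm hm, PowerSeries.coeff_C_mul_X_pow, avoidSeries, PowerSeries.coeff_mk]
  rw [Finset.sum_ite_eq, if_pos (by simp)]

theorem X_pow_dvd_signedTerm {m : ℕ} (hm : 0 < m) (k j : ℕ) :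
    PowerSeries.X ^ j ∣ signedTerm m k j := by
  have h : j ≤ j * m := Nat.le_mul_of_pos_right j hm
  exact dvd_sub ((pow_dvd_pow _ h).mul_left _) ((pow_dvd_pow _ (by omega)).mul_left _)

theorem sum_coeff_signedTerm {m : ℕ} (hm : 2 ≤ m) (k b : ℕ) {N : ℕ} (hN : b < N) :
    ∑ j ∈ range N, PowerSeries.coeff b (signedTerm m k j) =
      PowerSeries.coeff b (signedSeries m k) := by
  have hdiv : b / m < N := (Nat.div_le_self b m).trans_lt hN
  have hb := Nat.div_add_mod' b m
  have hmod := Nat.mod_lt b (show 0 < m by omega)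
  have key : ∀ s < m, ∑ j ∈ range N, (if b = j * m + s then
      decSum (PowerSeries.X : PowerSeries ℚ) (j * m + s) k ∅ else 0) =
        (if b % m = s then 1 else 0) * decSum PowerSeries.X b k ∅ := by
    intro s hs
    -- Since `s < m`, only `j = b / m` can give `b = j * m + s`.
    rw [Finset.sum_eq_single_of_mem (b / m) (Finset.mem_range.2 hdiv)]
    · by_cases h : b % m = s
      · rw [← h, hb]; simp
      · rw [if_neg h, zero_mul, if_neg (by omega)]
    · intro j _ hj
      refine if_neg fun e => hj ?_
      rw [e, mul_comm, Nat.mul_add_div (by omega), Nat.div_eq_of_lt hs, add_zero]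
  have h0 := key 0 (by omega)
  have h1 := key 1 (by omega)
  simp only [add_zero] at h0
  simp only [signedTerm, map_sub, PowerSeries.coeff_C_mul_X_pow, Finset.sum_sub_distrib, h0, h1,
    signedSeries, PowerSeries.coeff_mk, runSign, sub_mul]

theorem bracketTerm_succ (m k j : ℕ) :
    bracketTerm m (k + 1) j = PowerSeries.C (signedTerm m (k + 1) j) := by
  rw [bracketTerm, show k + 1 + j * m - 1 = k + j * m by omega,
    show k + 1 + j * m = k + (j * m + 1) by omega, Nat.add_sub_cancel, qBinom_eq_decSum,
    qBinom_eq_decSum, x_pow, x_pow, ← map_mul, ← map_mul, ← map_sub, signedTerm]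

theorem X_pow_dvd_coeff_bracketTerm {m : ℕ} (hm : 0 < m) (k a j : ℕ) :
    PowerSeries.X ^ j ∣ PowerSeries.coeff a (bracketTerm m (k + 1) j) := by
  rw [bracketTerm_succ, PowerSeries.coeff_C]
  split_ifs
  · exact X_pow_dvd_signedTerm hm _ _
  · exact dvd_zero _

theorem bracket_succ {m : ℕ} (hm : 2 ≤ m) (k : ℕ) :
    bracket m (k + 1) = PowerSeries.C (signedSeries m (k + 1)) := by
  ext1 a
  ext1 b
  rw [bracket, coeff_formalSum_of_X_pow_dvd (X_pow_dvd_coeff_bracketTerm (by omega) k) a b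
    (Nat.lt_succ_self b)]
  simp only [bracketTerm_succ, PowerSeries.coeff_C]
  split_ifs
  · exact sum_coeff_signedTerm hm _ _ (Nat.lt_succ_self b)
  · simp

theorem bracket_mul_avoidSeries {m : ℕ} (hm : 2 ≤ m) (k : ℕ) :
    bracket m (k + 1) * PowerSeries.C (avoidSeries m (k + 1)) = 1 := by
  rw [bracket_succ hm, ← map_mul, mul_comm, avoidSeries_mul_signedSeries hm, map_one]

theorem isUnit_bracket_succ {m : ℕ} (hm : 2 ≤ m) (k : ℕ) : IsUnit (bracket m (k + 1)) :=
  IsUnit.of_mul_eq_one _ (bracket_mul_avoidSeries hm k)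

theorem inverse_bracket_succ {m : ℕ} (hm : 2 ≤ m) (k : ℕ) :
    Ring.inverse (bracket m (k + 1)) = PowerSeries.C (avoidSeries m (k + 1)) := by
  rw [← mul_one (Ring.inverse _), ← bracket_mul_avoidSeries hm k, ← mul_assoc,
    Ring.inverse_mul_cancel _ (isUnit_bracket_succ hm k), one_mul]

/-! ### The Hadamard geometric series of (a) -/

theorem coeff_t_mul_x_pow_mul_invProd (r a : ℕ) :
    PowerSeries.coeff a (t * x ^ r * invProd r) =
      if a = 0 then 0 else
        PowerSeries.C (decSum PowerSeries.X r a ∅) * PowerSeries.X ^ r := by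
  have e : t * x ^ r * invProd r = invProd r * PowerSeries.C (PowerSeries.X ^ r) *
      PowerSeries.X := by rw [t, x_pow]; ring
  rw [e, invProd_eq_mk]
  rcases a with _ | a
  · simp
  · rw [if_neg a.succ_ne_zero, PowerSeries.coeff_succ_mul_X, PowerSeries.coeff_mul_C,
      PowerSeries.coeff_mk]

theorem coeff_clusterTerm (m j a : ℕ) :
    PowerSeries.coeff a (clusterTerm m j) = if a = 0 then 0 else signedTerm m a j := by
  rw [clusterTerm, map_sub, coeff_t_mul_x_pow_mul_invProd, coeff_t_mul_x_pow_mul_invProd]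
  split_ifs
  · exact sub_zero 0
  · rfl

theorem X_pow_dvd_coeff_clusterTerm {m : ℕ} (hm : 0 < m) (a j : ℕ) :
    PowerSeries.X ^ j ∣ PowerSeries.coeff a (clusterTerm m (j + 1)) := by
  rw [coeff_clusterTerm]
  split_ifs
  · exact dvd_zero _
  · exact (pow_dvd_pow _ j.le_succ).trans (X_pow_dvd_signedTerm hm _ _)

theorem inverse_eq_invProd_one : Ring.inverse ((1 - t) * (1 - t * q)) = invProd 1 := by
  rw [invProd, Finset.prod_range_succ, Finset.prod_range_one, pow_zero, pow_one, mul_one]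

theorem signedSeries_zero_right (m : ℕ) : signedSeries m 0 = 1 := by
  ext1 r
  rw [signedSeries, PowerSeries.coeff_mk, PowerSeries.coeff_one]
  rcases r with _ | r
  · simp [runSign, decSum_zero_left]
  · simp [decSum_succ_zero]

theorem coeff_hadamardBase {m : ℕ} (hm : 2 ≤ m) (a : ℕ) :
    PowerSeries.coeff a (hadamardBase m) = 1 - signedSeries m a := by
  ext1 b
  have h1 := coeff_t_mul_x_pow_mul_invProd 1 a
  rw [pow_one] at h1
  rw [hadamardBase, inverse_eq_invProd_one, map_sub, h1, map_sub,
    coeff_formalSum_of_X_pow_dvd (X_pow_dvd_coeff_clusterTerm (by omega)) a b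
      (Nat.lt_succ_self b)]
  simp only [coeff_clusterTerm]
  split_ifs with ha
  · rw [ha, signedSeries_zero_right]; simp
  · have hsum := sum_coeff_signedTerm hm a b (show b < b + 1 + 1 by omega)
    have h0 : signedTerm m a 0 =
        1 - PowerSeries.C (decSum PowerSeries.X 1 a ∅) * PowerSeries.X ^ 1 := by
      simp [signedTerm, decSum_zero_left]
    rw [Finset.sum_range_succ', h0, map_sub] at hsum
    rw [map_sub]
    linear_combination -hsum

theorem coeff_hadamardPow (f : TXQ) (n a : ℕ) :
    PowerSeries.coeff a (hadamardPow f n) = PowerSeries.coeff a f ^ n := by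
  induction n with
  | zero => simp [hadamardPow, hadamardOne]
  | succ n ih => rw [hadamardPow, hadamard, PowerSeries.coeff_mk, ih, pow_succ]

theorem X_pow_dvd_coeff_hadamardPow {m : ℕ} (hm : 2 ≤ m) (a n : ℕ) :
    PowerSeries.X ^ n ∣ PowerSeries.coeff a (hadamardPow (hadamardBase m) n) := by
  rw [coeff_hadamardPow, coeff_hadamardBase hm]
  refine pow_dvd_pow_of_dvd ?_ n
  rw [PowerSeries.X_dvd_iff, map_sub, map_one, ← PowerSeries.coeff_zero_eq_constantCoeff_apply]
  simp [signedSeries, runSign, decSum_zero_left]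

theorem coeff_formalSum_hadamardPow {m : ℕ} (hm : 2 ≤ m) (a : ℕ) :
    PowerSeries.coeff a (formalSum fun n => hadamardPow (hadamardBase m) n) = avoidSeries m a := by
  ext1 b
  rw [coeff_formalSum_of_X_pow_dvd (X_pow_dvd_coeff_hadamardPow hm) a b (Nat.lt_succ_self b)]
  have hdvd := X_pow_dvd_coeff_hadamardPow hm a (b + 1)
  simp only [coeff_hadamardPow] at hdvd ⊢
  have hV := avoidSeries_mul_signedSeries hm a
  rw [show signedSeries m a = 1 - PowerSeries.coeff a (hadamardBase m) by
    rw [coeff_hadamardBase hm]; ring] at hV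
  set y := PowerSeries.coeff a (hadamardBase m)
  -- Finite geometric sum with remainder; `y` has no constant term in `x`, so the remainder does not
  -- reach `x^b`.
  have hgeom : avoidSeries m a = ∑ n ∈ range (b + 1), y ^ n + avoidSeries m a * y ^ (b + 1) := by
    have := geom_sum_mul y (b + 1)
    linear_combination (∑ n ∈ range (b + 1), y ^ n) * hV + avoidSeries m a * this
  rw [hgeom, map_add, PowerSeries.X_pow_dvd_iff.1 (hdvd.mul_left _) b (Nat.lt_succ_self b),
    add_zero, map_sum]

/-! ### The sum of inverse brackets in (b) -/

theorem coeff_inverse_bracket_mul_t_pow {m : ℕ} (hm : 2 ≤ m) (k a : ℕ) :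
    PowerSeries.coeff a (Ring.inverse (bracket m (k + 1)) * t ^ (k + 1)) =
      if a = k + 1 then avoidSeries m (k + 1) else 0 := by
  rw [inverse_bracket_succ hm, t, PowerSeries.coeff_C_mul_X_pow]

theorem formalSummable_inverse_bracket {m : ℕ} (hm : 2 ≤ m) :
    FormalSummable fun k => Ring.inverse (bracket m (k + 1)) * t ^ (k + 1) := by
  intro a b c
  refine (Set.finite_Iic a).subset fun k hk => ?_
  by_contra hc
  rw [Set.mem_Iic, not_le] at hc
  refine hk ?_
  rw [coeff, coeff_inverse_bracket_mul_t_pow hm, if_neg (by omega), map_zero, map_zero]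

theorem avoidSeries_zero_right {m : ℕ} (hm : 2 ≤ m) : avoidSeries m 0 = 1 := by
  simpa [signedSeries_zero_right] using avoidSeries_mul_signedSeries hm 0

/-- Each positive power of `t` comes from a single summand. The leading `1` accounts for `t^0`: over
the empty alphabet only the empty word exists. -/
theorem coeff_formalSum_inverse_bracket {m : ℕ} (hm : 2 ≤ m) (a : ℕ) :
    PowerSeries.coeff a
      (1 + formalSum fun k => Ring.inverse (bracket m (k + 1)) * t ^ (k + 1)) =
        avoidSeries m a := by
  rw [map_add, PowerSeries.coeff_one]
  have h : PowerSeries.coeff a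
      (formalSum fun k => Ring.inverse (bracket m (k + 1)) * t ^ (k + 1)) =
        if a = 0 then 0 else avoidSeries m a := by
    ext b c
    simp only [formalSum, PowerSeries.coeff_mk, coeff, coeff_inverse_bracket_mul_t_pow hm]
    rcases a with _ | a
    · simp
    · rw [finsum_eq_single _ a]
      · simp
      · intro k hk
        rw [if_neg (by omega), map_zero, map_zero]
  rw [h]
  split_ifs with ha
  · rw [ha, avoidSeries_zero_right hm, add_zero]
  · rw [zero_add]

end TXQ

end

open TXQ in
/-- Every infinite sum in (a) and (b) converges formally, every bracket in (b) is invertible, and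
the two formulas hold. -/
theorem theorem4p2 (m : ℕ) (hm : 2 ≤ m) :
    FormalSummable (fun n => avoidTerm m n) ∧
    -- (a)
    (FormalSummable (fun j => clusterTerm m (j + 1)) ∧
      FormalSummable (fun n => hadamardPow (hadamardBase m) n) ∧
      formalSum (fun n => avoidTerm m n) =
        formalSum (fun n => hadamardPow (hadamardBase m) n)) ∧
    -- (b)
    ((∀ k : ℕ, 1 ≤ k → FormalSummable (fun j => bracketTerm m k j) ∧ IsUnit (bracket m k)) ∧
      FormalSummable (fun k => Ring.inverse (bracket m (k + 1)) * t ^ (k + 1)) ∧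
      formalSum (fun n => avoidTerm m n) =
        1 + formalSum (fun k => Ring.inverse (bracket m (k + 1)) * t ^ (k + 1))) := by
  have hpos : 0 < m := by omega
  refine ⟨formalSummable_of_X_pow_dvd (X_pow_dvd_coeff_avoidTerm hpos),
    ⟨formalSummable_of_X_pow_dvd (X_pow_dvd_coeff_clusterTerm hpos),
      formalSummable_of_X_pow_dvd (X_pow_dvd_coeff_hadamardPow hm), ?_⟩,
    fun k hk => ?_, formalSummable_inverse_bracket hm, ?_⟩
  · ext1 a
    rw [coeff_formalSum_avoidTerm hpos, coeff_formalSum_hadamardPow hm]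
  · obtain ⟨k, rfl⟩ : ∃ k', k = k' + 1 := ⟨k - 1, by omega⟩
    exact ⟨formalSummable_of_X_pow_dvd (X_pow_dvd_coeff_bracketTerm hpos k),
      isUnit_bracket_succ hm k⟩
  · ext1 a
    rw [coeff_formalSum_avoidTerm hpos, coeff_formalSum_inverse_bracket hm]
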